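/- Let $\mathcal X$ be a finite set, $\mathcal Y$ a set, and $\mathcal C\subseteq\mathcal Y^{\mathcal X}$ a finite non-empty class of hypotheses, with loss functions $L_h:\mathcal X\times\mathcal Y\to[0,1]$ for $h\in\mathcal C$. Let $m\ge 1$. For $h\in\mathcal C$ and a distribution $P$ on $\mathcal X^m$, write $S_h=((x_1,h(x_1)),\dots,(x_m,h(x_m)))$ with $(x_1,\dots,x_m)\sim P$. A learning algorithm $A$ for $\mathcal C$ with sample size $m$ is a randomized map that takes a sample $S$ realizable by $\mathcal C$ to a (random) function $A(S):\mathcal X\to\mathcal Y$, with finitely many possible outputs on each sample (automatic when $\mathcal Y$ is finite). With respect to the target $h$, a function $f:\mathcal X\to\mathcal Y$ has empirical error $\frac1m\sum_{i=1}^m L_h(x_i,f(x_i))$ on the points $x_1,\dots,x_m$, and true error $\mathrm{error}_h(f;X)=\mathbb E_{x\sim X}L_h(x,f(x))$ with respect to a distribution $X$ on $\mathcal X$. Mutual information $I$ is measured in bits. For a set $\mathcal D$ of distributions on $\mathcal X^m$, call $A$ a minimax algorithm for $(\mathcal C,\mathcal D)$ with information $K$ and empirical error $\epsilon$ if, for every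 $P\in\mathcal D$, the output $A(S_h)$ always (with probability one) has empirical error at most $\epsilon$ on $S_h$, for every $h\in\mathcal C$, and $$\frac1{|\mathcal C|}\sum_{h\in\mathcal C} I(S_h;A(S_h))\le K .$$ There is an absolute constant $c>0$ such that the following holds for all such $\mathcal X,\mathcal Y,\mathcal C,(L_h)_{h\in\mathcal C},m$. Let $\mathcal D_0$ be a convex set of distributions on $\mathcal X$, let $\mathcal D$ be the convex hull of the product distributions $X^m$ with $X\in\mathcal D_0$, let $\epsilon,\delta>0$ and $K\in\mathbb R$, and let $A$ be a minimax algorithm for $(\mathcal C,\mathcal D)$ with information $K$ and empirical error $\epsilon$. Let $X\in\mathcal D_0$ and suppose that $m\ge \frac{K}{\epsilon^2\delta}$. Then $$\Pr[\mathrm{error}_h(A(S_h);X)>2\epsilon]<c\,\delta ,$$ where $h$ is uniform in $\mathcal C$, $(x_1,\dots,x_m)\sim X^m$ is independent of $h$, and the probability is over $h$, the sample and the randomness of $A$. In particular, for at least half of the $h\in\mathcal C$, the same bound $$\Pr[\mathrm{error}_h(A(S_h);X)>2\epsilon]<c\,\delta$$ holds with $h$ fixed, the probability being over the sample and the randomness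 of $A$. -/

import Mathlib

open scoped BigOperators

namespace InfoLearning

noncomputable section

/-! ## Distributions, entropy and mutual information -/

/-- The real-valued probability mass function of a discrete distribution. -/
def mass {α : Type*} (p : PMF α) : α → ℝ := fun a => (p a).toReal

/-- The probability of the event `E` under the discrete distribution `p`. -/
def prob {α : Type*} (p : PMF α) (E : Set α) : ℝ := (p.toOuterMeasure E).toReal

/-- Shannon entropy in bits, `H(p) = ∑ p(a) log₂ (1 / p(a))`, where `0 log (1 / 0) = 0`.
It is only used for distributions of finite support, so the sum has finitely many nonzero terms. -/
def entropy {α : Type*} (p : PMF α) : ℝ := ∑' a, mass p a * Real.logb 2 (1 / mass p a)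

/-- Mutual information `I(U; V) = H(U) + H(V) - H(U, V)` of a pair `(U, V)` with joint law `J`. -/
def mutualInfo {α β : Type*} (J : PMF (α × β)) : ℝ :=
  entropy (J.map Prod.fst) + entropy (J.map Prod.snd) - entropy J

/-- The product distribution `X^m`: the law of `m` independent copies of `X`. -/
def iid {𝒳 : Type*} [Fintype 𝒳] (X : PMF 𝒳) (m : ℕ) : PMF (Fin m → 𝒳) :=
  PMF.ofFintype (fun x => ∏ i, X (x i)) (by
    classical
    have h := Finset.prod_univ_sum (fun _ : Fin m => (Finset.univ : Finset 𝒳))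
      (fun _ a => X a)
    rw [Fintype.piFinset_univ] at h
    have h1 : ∑ a, X a = 1 := by rw [← tsum_fintype (L := .unconditional _)]; exact X.tsum_coe
    rw [← h]
    simp [h1])

/-- A set of distributions is convex if it is closed under mixtures. -/
def IsConvexSet {α : Type*} (D : Set (PMF α)) : Prop := Convex ℝ (mass '' D)

/-- The convex hull of the distributions `X^m` with `X ∈ D₀`. -/
def productHull {𝒳 : Type*} [Fintype 𝒳] (D₀ : Set (PMF 𝒳)) (m : ℕ) :
    Set (PMF (Fin m → 𝒳)) :=
  {P | mass P ∈ convexHull ℝ ((fun X => mass (iid X m)) '' D₀)}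

/-! ## Learning algorithms -/

variable {𝒳 𝒴 : Type*}

/-- Realizable samples of size `m` for the class `C`. -/
def RealizableSample (C : Finset (𝒳 → 𝒴)) (m : ℕ) : Type _ :=
  {s : Fin m → 𝒳 × 𝒴 // ∃ h ∈ C, ∀ i, (s i).2 = h (s i).1}

/-- The sample `((x₁, h(x₁)), …, (x_m, h(x_m)))`. -/
def labelled {C : Finset (𝒳 → 𝒴)} {m : ℕ} (h : C) (x : Fin m → 𝒳) : RealizableSample C m :=
  ⟨fun i => (x i, h.1 (x i)), h.1, h.2, fun _ => rfl⟩

/-- A (randomized, not necessarily proper) learning algorithm for `C` with sample size `m`.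
It sends each realizable sample to the law of its output, a function `𝒳 → 𝒴`. The finiteness
condition, automatic for finite `𝒳` and `𝒴`, makes the output a finite random variable. -/
structure LearningAlgorithm (C : Finset (𝒳 → 𝒴)) (m : ℕ) where
  /-- the law of the output on a given sample -/
  out : RealizableSample C m → PMF (𝒳 → 𝒴)
  finite_support : ∀ s, (out s).support.Finite

/-- The law of the sample `S_h` when `(x₁, …, x_m) ∼ P` and the labels are given by `h`. -/
def sampleLaw {C : Finset (𝒳 → 𝒴)} {m : ℕ} (P : PMF (Fin m → 𝒳)) (h : C) :
    PMF (RealizableSample C m) :=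
  P.map (labelled h)

/-- The joint law of `(S_h, A(S_h))`. -/
def jointLaw {C : Finset (𝒳 → 𝒴)} {m : ℕ} (A : LearningAlgorithm C m)
    (P : PMF (Fin m → 𝒳)) (h : C) : PMF (RealizableSample C m × (𝒳 → 𝒴)) :=
  (sampleLaw P h).bind fun s => (A.out s).map fun f => (s, f)

/-- The law of the output `A(S_h)`. -/
def outputLaw {C : Finset (𝒳 → 𝒴)} {m : ℕ} (A : LearningAlgorithm C m)
    (P : PMF (Fin m → 𝒳)) (h : C) : PMF (𝒳 → 𝒴) :=
  (jointLaw A P h).map Prod.snd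

/-- The joint law of `(h, A(S_h))` when `h` is uniform in `C` and, independently,
`(x₁, …, x_m) ∼ P`. -/
def uniformOutputLaw {C : Finset (𝒳 → 𝒴)} [Nonempty C] {m : ℕ} (A : LearningAlgorithm C m)
    (P : PMF (Fin m → 𝒳)) : PMF (C × (𝒳 → 𝒴)) :=
  (PMF.uniformOfFintype C).bind fun h => (outputLaw A P h).map fun f => (h, f)

/-- The empirical error of `f` on the sample `s`, with loss `L h x y` for the target `h`. -/
def empiricalError {C : Finset (𝒳 → 𝒴)} {m : ℕ} (L : C → 𝒳 → 𝒴 → ℝ) (h : C)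
    (s : RealizableSample C m) (f : 𝒳 → 𝒴) : ℝ :=
  (1 / (m : ℝ)) * ∑ i, L h (s.1 i).1 (f (s.1 i).1)

/-- The true error `𝔼_{x ∼ X} L_h(x, f(x))`. -/
def trueError [Fintype 𝒳] {C : Finset (𝒳 → 𝒴)} (L : C → 𝒳 → 𝒴 → ℝ) (h : C)
    (X : PMF 𝒳) (f : 𝒳 → 𝒴) : ℝ :=
  ∑ x, mass X x * L h x (f x)

/-- `A` is a minimax algorithm for `(C, D)` with information `K` and empirical error `ε`: against
every distribution in `D`, its outputs always have empirical error at most `ε`, whatever the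
target in `C`, and the information it reveals, averaged over the targets in `C`, is at most
`K` bits. -/
def IsMinimaxAlgorithm {C : Finset (𝒳 → 𝒴)} {m : ℕ} (L : C → 𝒳 → 𝒴 → ℝ)
    (D : Set (PMF (Fin m → 𝒳))) (A : LearningAlgorithm C m) (K ε : ℝ) : Prop :=
  ∀ P ∈ D,
    (∀ h : C, ∀ s ∈ (sampleLaw P h).support, ∀ f ∈ (A.out s).support,
      empiricalError L h s f ≤ ε) ∧
    (1 / (C.card : ℝ)) * ∑ h : C, mutualInfo (jointLaw A P h) ≤ K

end

end InfoLearning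

/-!
The information `I(S_h; A(S_h))` is large as soon as `A` outputs bad functions with noticeable
probability, because a function with true error above `2ε` fits a random sample up to empirical
error `ε` only with exponentially small probability.

Quantitatively, the Donsker–Varadhan inequality (`sum_mul_le_mutualInfo`) bounds `𝔼 Φ(U, V)` by
`I(U; V)` (in nats) whenever `𝔼 exp Φ(U, v) ≤ 1` for every `v`, with `U` distributed as the first
marginal. It is applied to the sample `U = S_h`, the output `V = f`, and
`Φ = (2/3) m ε - (1/2) ∑ᵢ L_h(xᵢ, f(xᵢ))` if `f` has true error above `2ε`, and `Φ = 0` otherwise.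
The exponential moment is at most `1` by independence of the points and the inequality
`exp (-t/2) ≤ 1 - t/3` on `[0, 1]` (`sum_iid_mul_exp_le_one`), while every pair `(S_h, A(S_h))` that
actually occurs has empirical error at most `ε`, so that `Φ ≥ m ε / 6` there on the bad event. Hence
`Pr[bad] m ε / 6 ≤ log 2 · I(S_h; A(S_h))` for each target `h` (`prob_trueError_mul_le`). Averaging
over `h` bounds the overall probability by `3 δ`, and Markov's inequality gives the bound for at
least half of the targets. The only distribution of the convex hull on which the hypothesis on `A`
is used is `X^m` itself.
-/

namespace InfoLearning

/-! ### Discrete distributions of finite support -/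

lemma mass_nonneg {α : Type*} (p : PMF α) (a : α) : 0 ≤ mass p a := ENNReal.toReal_nonneg

lemma mass_pos {α : Type*} {p : PMF α} {a : α} (h : a ∈ p.support) : 0 < mass p a :=
  ENNReal.toReal_pos ((PMF.mem_support_iff _ _).1 h) (p.apply_ne_top a)

lemma mass_eq_zero {α : Type*} {p : PMF α} {a : α} (h : a ∉ p.support) : mass p a = 0 := by
  simp [mass, (PMF.apply_eq_zero_iff p a).2 h]

lemma mass_map {α β : Type*} [DecidableEq β] (p : PMF α) (hp : p.support.Finite) (k : α → β)
    (b : β) : mass (p.map k) b = ∑ a ∈ hp.toFinset, if b = k a then mass p a else 0 := by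
  classical
  unfold mass
  rw [PMF.map_apply, tsum_eq_sum (s := hp.toFinset), ENNReal.toReal_sum]
  · refine Finset.sum_congr rfl fun a _ => ?_
    by_cases h : b = k a <;> simp [h]
  · intro a _
    split_ifs
    · exact p.apply_ne_top a
    · simp
  · intro a ha
    have : p a = 0 := (PMF.apply_eq_zero_iff p a).2 (by simpa using ha)
    simp [this]

/-- Change of variables: the expectation of `g` under the image law `p.map k`. -/
lemma tsum_mass_map_mul {α β : Type*} (p : PMF α) (hp : p.support.Finite) (k : α → β)
    (g : β → ℝ) : ∑' b, mass (p.map k) b * g b = ∑ a ∈ hp.toFinset, mass p a * g (k a) := by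
  classical
  rw [tsum_eq_sum (s := hp.toFinset.image k)]
  · simp_rw [mass_map p hp, Finset.sum_mul, ite_mul, zero_mul]
    rw [Finset.sum_comm]
    refine Finset.sum_congr rfl fun a ha => ?_
    rw [Finset.sum_ite_eq' _ _ fun b => mass p a * g b, if_pos (Finset.mem_image_of_mem k ha)]
  · intro b hb
    rw [mass_eq_zero, zero_mul]
    intro h
    obtain ⟨a, ha, rfl⟩ := (PMF.mem_support_map_iff _ _ _).1 h
    exact hb (Finset.mem_image_of_mem k (by simpa using ha))

lemma tsum_mass_mul {α : Type*} (p : PMF α) (hp : p.support.Finite) (g : α → ℝ) :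
    ∑' a, mass p a * g a = ∑ a ∈ hp.toFinset, mass p a * g a := by
  simpa [PMF.map_id] using tsum_mass_map_mul p hp id g

lemma sum_mass_eq_one {α : Type*} (p : PMF α) (hp : p.support.Finite) :
    ∑ a ∈ hp.toFinset, mass p a = 1 := by
  have h : ∑' a, mass p a = 1 := by
    unfold mass
    rw [← ENNReal.tsum_toReal_eq p.apply_ne_top, p.tsum_coe, ENNReal.toReal_one]
  rw [← h]
  simpa using (tsum_mass_mul p hp fun _ => 1).symm

lemma sum_univ_mass_eq_one {α : Type*} [Fintype α] (p : PMF α) : ∑ a, mass p a = 1 := by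
  rw [← sum_mass_eq_one p (Set.toFinite _)]
  refine (Finset.sum_subset (Finset.subset_univ _) fun a _ ha => ?_).symm
  exact mass_eq_zero (by simpa using ha)

lemma prob_eq_tsum {α : Type*} (p : PMF α) (E : Set α) :
    prob p E = ∑' a, mass p a * E.indicator 1 a := by
  classical
  unfold prob mass
  rw [PMF.toOuterMeasure_apply, ENNReal.tsum_toReal_eq]
  · refine tsum_congr fun a => ?_
    by_cases h : a ∈ E <;> simp [h]
  · intro a
    by_cases h : a ∈ E <;> simp [h, p.apply_ne_top]

lemma prob_nonneg {α : Type*} (p : PMF α) (E : Set α) : 0 ≤ prob p E := ENNReal.toReal_nonneg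

/-! ### A variational lower bound on mutual information -/

/-- Mutual information, in nats, as the expectation of the log-density of the joint law with respect
to the product of its marginals. -/
lemma log_two_mul_mutualInfo {α β : Type*} (J : PMF (α × β)) (hJ : J.support.Finite) :
    Real.log 2 * mutualInfo J = ∑ t ∈ hJ.toFinset, mass J t *
      (Real.log (mass J t) - Real.log (mass (J.map Prod.fst) t.1)
        - Real.log (mass (J.map Prod.snd) t.2)) := by
  unfold mutualInfo entropy
  rw [tsum_mass_map_mul J hJ Prod.fst fun u => Real.logb 2 (1 / mass (J.map Prod.fst) u),
    tsum_mass_map_mul J hJ Prod.snd fun v => Real.logb 2 (1 / mass (J.map Prod.snd) v),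
    tsum_mass_mul J hJ fun t => Real.logb 2 (1 / mass J t),
    ← Finset.sum_add_distrib, ← Finset.sum_sub_distrib, Finset.mul_sum]
  refine Finset.sum_congr rfl fun t _ => ?_
  have h2 : Real.log 2 ≠ 0 := (Real.log_pos one_lt_two).ne'
  simp only [Real.logb, one_div, Real.log_inv]
  field_simp
  ring

/-- The Donsker–Varadhan inequality for the joint law `J` against the product of its marginals, with
the exponential moment of the test function `Φ` normalised separately for each second coordinate. -/
lemma sum_mul_le_mutualInfo {α β : Type*} (J : PMF (α × β)) (hJ : J.support.Finite)
    (Φ : α → β → ℝ)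
    (hΦ : ∀ v, ∑' u, mass (J.map Prod.fst) u * Real.exp (Φ u v) ≤ 1) :
    ∑ t ∈ hJ.toFinset, mass J t * Φ t.1 t.2 ≤ Real.log 2 * mutualInfo J := by
  classical
  have hfst : (J.map Prod.fst).support.Finite := by
    rw [PMF.support_map]; exact hJ.image _
  have hsnd : (J.map Prod.snd).support.Finite := by
    rw [PMF.support_map]; exact hJ.image _
  have hmem : ∀ t ∈ hJ.toFinset,
      t.1 ∈ (J.map Prod.fst).support ∧ t.2 ∈ (J.map Prod.snd).support := by
    intro t ht
    have ht' : t ∈ J.support := by simpa using ht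
    exact ⟨(PMF.mem_support_map_iff _ _ _).2 ⟨t, ht', rfl⟩,
      (PMF.mem_support_map_iff _ _ _).2 ⟨t, ht', rfl⟩⟩
  have hprod : ∑ t ∈ hJ.toFinset,
      mass (J.map Prod.fst) t.1 * mass (J.map Prod.snd) t.2 * Real.exp (Φ t.1 t.2) ≤ 1 := by
    calc _ ≤ ∑ t ∈ hfst.toFinset ×ˢ hsnd.toFinset,
          mass (J.map Prod.fst) t.1 * mass (J.map Prod.snd) t.2 * Real.exp (Φ t.1 t.2) := by
          refine Finset.sum_le_sum_of_subset_of_nonneg (fun t ht => ?_) fun t _ _ => ?_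
          · simpa using hmem t ht
          · exact mul_nonneg (mul_nonneg (mass_nonneg _ _) (mass_nonneg _ _)) (Real.exp_nonneg _)
      _ = ∑ v ∈ hsnd.toFinset, mass (J.map Prod.snd) v *
          ∑' u, mass (J.map Prod.fst) u * Real.exp (Φ u v) := by
          rw [Finset.sum_product_right]
          refine Finset.sum_congr rfl fun v _ => ?_
          rw [tsum_mass_mul _ hfst fun u => Real.exp (Φ u v), Finset.mul_sum]
          exact Finset.sum_congr rfl fun u _ => by ring
      _ ≤ ∑ v ∈ hsnd.toFinset, mass (J.map Prod.snd) v :=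
          Finset.sum_le_sum fun v _ => mul_le_of_le_one_right (mass_nonneg _ _) (hΦ v)
      _ = 1 := sum_mass_eq_one _ hsnd
  rw [log_two_mul_mutualInfo J hJ]
  -- Gibbs' inequality, from `log y ≤ y - 1` at `y = p_U p_V exp Φ / J`.
  have hterm : ∀ t ∈ hJ.toFinset, mass J t * Φ t.1 t.2 ≤
      mass J t * (Real.log (mass J t) - Real.log (mass (J.map Prod.fst) t.1)
        - Real.log (mass (J.map Prod.snd) t.2)) +
      (mass (J.map Prod.fst) t.1 * mass (J.map Prod.snd) t.2 * Real.exp (Φ t.1 t.2)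
        - mass J t) := by
    intro t ht
    have hj : 0 < mass J t := mass_pos (by simpa using ht)
    have hu := mass_pos (hmem t ht).1
    have hv := mass_pos (hmem t ht).2
    have hlog := Real.log_le_sub_one_of_pos
      (div_pos (mul_pos (mul_pos hu hv) (Real.exp_pos (Φ t.1 t.2))) hj)
    rw [Real.log_div (by positivity) hj.ne', Real.log_mul (by positivity) (by positivity),
      Real.log_mul hu.ne' hv.ne', Real.log_exp] at hlog
    have h := mul_le_mul_of_nonneg_left hlog hj.le
    rw [mul_sub (mass J t) (_ / _), mul_div_cancel₀ _ hj.ne'] at h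
    linarith
  have h := Finset.sum_le_sum hterm
  rw [Finset.sum_add_distrib, Finset.sum_sub_distrib, sum_mass_eq_one J hJ] at h
  linarith

/-! ### Exponential moments of the empirical error -/

lemma exp_neg_half_le {t : ℝ} (h0 : 0 ≤ t) (h1 : t ≤ 1) : Real.exp (-(t / 2)) ≤ 1 - t / 3 := by
  rw [Real.exp_neg]
  have h : 1 + t / 2 ≤ Real.exp (t / 2) := by linarith [Real.add_one_le_exp (t / 2)]
  refine (inv_anti₀ (by positivity) h).trans ?_
  rw [inv_le_iff_one_le_mul₀ (by positivity)]
  nlinarith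

/-- If a `[0, 1]`-valued loss has mean at least `2ε`, its sum over `m` independent points has a
sub-normalised exponential moment. -/
lemma sum_iid_mul_exp_le_one {𝒳 : Type*} [Fintype 𝒳] (X : PMF 𝒳) (m : ℕ) (ℓ : 𝒳 → ℝ)
    (hℓ : ∀ x, 0 ≤ ℓ x ∧ ℓ x ≤ 1) (ε : ℝ) (hmean : 2 * ε ≤ ∑ x, mass X x * ℓ x) :
    ∑ x : Fin m → 𝒳, mass (iid X m) x * Real.exp (2 / 3 * m * ε - (∑ i, ℓ (x i)) / 2) ≤ 1 := by
  have hone : ∑ x, mass X x * Real.exp (-(ℓ x / 2)) ≤ Real.exp (-(2 / 3 * ε)) := by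
    calc _ ≤ ∑ x, mass X x * (1 - ℓ x / 3) := Finset.sum_le_sum fun x _ =>
          mul_le_mul_of_nonneg_left (exp_neg_half_le (hℓ x).1 (hℓ x).2) (mass_nonneg _ _)
      _ = 1 - (∑ x, mass X x * ℓ x) / 3 := by
          simp only [mul_sub, mul_one, Finset.sum_sub_distrib, sum_univ_mass_eq_one,
            Finset.sum_div, mul_div_assoc]
      _ ≤ -(2 / 3 * ε) + 1 := by linarith
      _ ≤ _ := Real.add_one_le_exp _
  have hfactor : ∀ x : Fin m → 𝒳,
      mass (iid X m) x * Real.exp (2 / 3 * m * ε - (∑ i, ℓ (x i)) / 2) =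
        Real.exp (2 / 3 * m * ε) * ∏ i, mass X (x i) * Real.exp (-(ℓ (x i) / 2)) := by
    intro x
    have : mass (iid X m) x = ∏ i, mass X (x i) := by
      simp [mass, iid, PMF.ofFintype_apply, ENNReal.toReal_prod]
    rw [this, Finset.prod_mul_distrib, ← Real.exp_sum, sub_eq_add_neg, Real.exp_add,
      Finset.sum_neg_distrib, Finset.sum_div]
    ring
  simp_rw [hfactor]
  rw [← Finset.mul_sum, ← Fintype.sum_pow fun x => mass X x * Real.exp (-(ℓ x / 2))]
  calc _ ≤ Real.exp (2 / 3 * m * ε) * Real.exp (-(2 / 3 * ε)) ^ m := by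
        gcongr
        exact Finset.sum_nonneg fun x _ => mul_nonneg (mass_nonneg _ _) (Real.exp_nonneg _)
    _ = 1 := by
        rw [← Real.exp_nat_mul, ← Real.exp_add, Real.exp_eq_one_iff]
        ring

/-! ### Bad outputs cost information -/

section

variable {𝒳 𝒴 : Type*} {C : Finset (𝒳 → 𝒴)} {m : ℕ}

lemma mem_support_jointLaw (A : LearningAlgorithm C m) (P : PMF (Fin m → 𝒳)) (h : C)
    (t : RealizableSample C m × (𝒳 → 𝒴)) :
    t ∈ (jointLaw A P h).support ↔ t.1 ∈ (sampleLaw P h).support ∧ t.2 ∈ (A.out t.1).support := by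
  unfold jointLaw
  simp only [PMF.mem_support_bind_iff, PMF.mem_support_map_iff]
  constructor
  · rintro ⟨s, hs, f, hf, rfl⟩
    exact ⟨hs, hf⟩
  · rintro ⟨hs, hf⟩
    exact ⟨t.1, hs, t.2, hf, rfl⟩

lemma finite_support_jointLaw [Fintype 𝒳] (A : LearningAlgorithm C m) (P : PMF (Fin m → 𝒳))
    (h : C) : (jointLaw A P h).support.Finite := by
  have hs : (sampleLaw P h).support.Finite := by
    unfold sampleLaw
    rw [PMF.support_map]
    exact (Set.toFinite _).image _
  refine (hs.biUnion fun s _ => (A.finite_support s).image (Prod.mk s)).subset fun t ht => ?_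
  obtain ⟨h1, h2⟩ := (mem_support_jointLaw A P h t).1 ht
  exact Set.mem_biUnion h1 ⟨t.2, h2, rfl⟩

lemma map_fst_jointLaw (A : LearningAlgorithm C m) (P : PMF (Fin m → 𝒳)) (h : C) :
    (jointLaw A P h).map Prod.fst = sampleLaw P h := by
  unfold jointLaw
  simp only [PMF.map_bind, PMF.map_comp, Function.comp_def]
  change ((sampleLaw P h).bind fun s => (A.out s).map (Function.const _ s)) = _
  simp only [PMF.map_const, PMF.bind_pure]

/-- For a fixed target `h`, an algorithm of empirical error at most `ε` reveals information
proportional to `m ε` times the probability that its true error exceeds `2ε`. -/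
lemma prob_trueError_mul_le [Fintype 𝒳] (L : C → 𝒳 → 𝒴 → ℝ)
    (hL : ∀ h x y, 0 ≤ L h x y ∧ L h x y ≤ 1) (hm : 1 ≤ m) (ε : ℝ)
    (A : LearningAlgorithm C m) (X : PMF 𝒳) (h : C)
    (hA : ∀ s ∈ (sampleLaw (iid X m) h).support, ∀ f ∈ (A.out s).support,
      empiricalError L h s f ≤ ε) :
    prob (outputLaw A (iid X m) h) {f | 2 * ε < trueError L h X f} * (m * ε / 6) ≤
      Real.log 2 * mutualInfo (jointLaw A (iid X m) h) := by
  classical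
  set J := jointLaw A (iid X m) h with hJdef
  have hJ : J.support.Finite := finite_support_jointLaw A _ h
  set B : Set (𝒳 → 𝒴) := {f | 2 * ε < trueError L h X f} with hB
  let Φ : RealizableSample C m → (𝒳 → 𝒴) → ℝ := fun s f =>
    B.indicator (fun f => 2 / 3 * m * ε - (∑ i, L h (s.1 i).1 (f (s.1 i).1)) / 2) f
  have hΦ : ∀ f, ∑' s, mass (J.map Prod.fst) s * Real.exp (Φ s f) ≤ 1 := by
    intro f
    have hsupp : (iid X m).support.Finite := Set.toFinite _
    rw [hJdef, map_fst_jointLaw, sampleLaw,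
      tsum_mass_map_mul _ hsupp (labelled h) fun s => Real.exp (Φ s f)]
    by_cases hf : f ∈ B
    · refine le_trans (Finset.sum_le_sum_of_subset_of_nonneg (Finset.subset_univ _)
        fun x _ _ => mul_nonneg (mass_nonneg _ _) (Real.exp_nonneg _)) ?_
      simp only [Φ, Set.indicator_of_mem hf]
      exact sum_iid_mul_exp_le_one X m (fun x => L h x (f x)) (fun x => hL _ _ _) ε
        (le_of_lt hf)
    · simp only [Φ, Set.indicator_of_notMem hf, Real.exp_zero, mul_one]
      exact (sum_mass_eq_one _ hsupp).le
  refine le_trans ?_ (sum_mul_le_mutualInfo J hJ Φ hΦ)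
  rw [outputLaw, ← hJdef, prob_eq_tsum, tsum_mass_map_mul J hJ Prod.snd fun f => B.indicator 1 f,
    Finset.sum_mul]
  refine Finset.sum_le_sum fun t ht => ?_
  rw [mul_assoc]
  refine mul_le_mul_of_nonneg_left ?_ (mass_nonneg _ _)
  by_cases hf : t.2 ∈ B
  · obtain ⟨hs, hfs⟩ := (mem_support_jointLaw A _ h t).1 (by simpa using ht)
    have hemp := hA _ hs _ hfs
    have hm0 : (0 : ℝ) < m := by exact_mod_cast hm
    rw [empiricalError, one_div, inv_mul_le_iff₀ hm0] at hemp
    simp only [Φ, Set.indicator_of_mem hf, Pi.one_apply]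
    linarith
  · simp [Φ, Set.indicator_of_notMem hf]

lemma prob_uniformOutputLaw [Nonempty C] (A : LearningAlgorithm C m) (P : PMF (Fin m → 𝒳))
    (E : Set (C × (𝒳 → 𝒴))) :
    prob (uniformOutputLaw A P) E =
      (1 / (C.card : ℝ)) * ∑ h : C, prob (outputLaw A P h) {f | (h, f) ∈ E} := by
  unfold prob uniformOutputLaw
  rw [PMF.toOuterMeasure_bind_apply, tsum_fintype, ENNReal.toReal_sum, Finset.mul_sum]
  · refine Finset.sum_congr rfl fun h _ => ?_
    rw [ENNReal.toReal_mul, PMF.toOuterMeasure_map_apply]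
    simp [Set.preimage]
  · intro h _
    refine ENNReal.mul_ne_top (PMF.apply_ne_top _ _) ?_
    rw [PMF.toOuterMeasure_map_apply]
    rw [PMF.toOuterMeasure_apply]
    exact (outputLaw A P h).tsum_coe_indicator_ne_top _

end

/-! ### Averaging over the target -/

/-- Markov's inequality: a nonnegative function with mean at most `c/2` is below `c` on at least half
of a finite type. -/
lemma card_le_two_mul_ncard_lt {ι : Type*} [Fintype ι] (g : ι → ℝ) (hg : ∀ i, 0 ≤ g i) {c : ℝ}
    (hc : 0 < c) (hsum : ∑ i, g i ≤ Fintype.card ι * (c / 2)) :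
    Fintype.card ι ≤ 2 * Set.ncard {i | g i < c} := by
  classical
  have hcard : Set.ncard {i | g i < c} = (Finset.univ.filter fun i => g i < c).card := by
    rw [← Set.ncard_coe_finset]; simp
  have hsplit := Finset.card_filter_add_card_filter_not (s := (Finset.univ : Finset ι))
    fun i => g i < c
  have hbad : ((Finset.univ.filter fun i => ¬ g i < c).card : ℝ) * c ≤ ∑ i, g i := by
    rw [← nsmul_eq_mul]
    refine (Finset.card_nsmul_le_sum _ g c fun i hi => ?_).trans
      (Finset.sum_le_sum_of_subset_of_nonneg (Finset.subset_univ _) fun i _ _ => hg i)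
    simpa using hi
  have hbad2 : 2 * ((Finset.univ.filter fun i => ¬ g i < c).card : ℝ) ≤ Fintype.card ι := by
    refine le_of_mul_le_mul_right ?_ hc
    linarith
  have hbad3 : 2 * (Finset.univ.filter fun i => ¬ g i < c).card ≤ Fintype.card ι := by
    exact_mod_cast hbad2
  rw [Finset.card_univ] at hsplit
  omega

end InfoLearning

open InfoLearning in
theorem mainTheorem4 :
    ∃ c : ℝ, 0 < c ∧
      ∀ (𝒳 : Type*) [Fintype 𝒳] (𝒴 : Type*)
        (C : Finset (𝒳 → 𝒴)) [Nonempty C]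
        (L : C → 𝒳 → 𝒴 → ℝ) (_hL : ∀ h x y, 0 ≤ L h x y ∧ L h x y ≤ 1)
        (D₀ : Set (PMF 𝒳)) (_hD₀ : InfoLearning.IsConvexSet D₀)
        (m : ℕ) (_hm : 1 ≤ m) (K ε δ : ℝ) (_hε : 0 < ε) (_hδ : 0 < δ)
        (A : InfoLearning.LearningAlgorithm C m)
        (_hA : InfoLearning.IsMinimaxAlgorithm L (InfoLearning.productHull D₀ m) A K ε)
        (X : PMF 𝒳) (_hX : X ∈ D₀) (_hmK : K / (ε ^ 2 * δ) ≤ (m : ℝ)),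
        InfoLearning.prob (InfoLearning.uniformOutputLaw A (InfoLearning.iid X m))
            {q | 2 * ε < InfoLearning.trueError L q.1 X q.2} < c * δ ∧
        C.card ≤ 2 * Set.ncard {h : C |
          InfoLearning.prob (InfoLearning.outputLaw A (InfoLearning.iid X m) h)
            {f | 2 * ε < InfoLearning.trueError L h X f} < c * δ} := by
  refine ⟨8, by norm_num, ?_⟩
  intro 𝒳 _ 𝒴 C _ L hL D₀ _ m hm K ε δ hε hδ A hA X hX hmK
  obtain ⟨hemp, hinfo⟩ := hA (iid X m) (subset_convexHull ℝ _ ⟨X, hX, rfl⟩)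
  set p : C → ℝ := fun h => prob (outputLaw A (iid X m) h) {f | 2 * ε < trueError L h X f} with hp
  have hp0 : ∀ h, 0 ≤ p h := fun h => prob_nonneg _ _
  have hm0 : (0 : ℝ) < m := by exact_mod_cast hm
  have hC : (0 : ℝ) < C.card := by
    exact_mod_cast Finset.card_pos.2 (Finset.nonempty_coe_sort.1 inferInstance)
  have hbound : ∀ h, p h * (m * ε ^ 2) ≤ 3 * mutualInfo (jointLaw A (iid X m) h) := by
    intro h
    have h1 : p h * (m * ε / 6) ≤ Real.log 2 * mutualInfo (jointLaw A (iid X m) h) :=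
      prob_trueError_mul_le L hL hm ε A X h (hemp h)
    have hI : 0 ≤ mutualInfo (jointLaw A (iid X m) h) :=
      nonneg_of_mul_nonneg_right ((mul_nonneg (hp0 h) (by positivity)).trans h1)
        (Real.log_pos one_lt_two)
    have hlog : Real.log 2 ≤ 1 := by linarith [Real.log_two_lt_d9]
    have h2 : p h * (m * ε / 6) ≤ mutualInfo (jointLaw A (iid X m) h) :=
      h1.trans (mul_le_of_le_one_left hI hlog)
    -- The true error never exceeds `1`, so the bad event is empty unless `ε < 1/2`.
    rcases lt_or_ge ε (1 / 2) with hlt | hge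
    · have : p h * (m * ε ^ 2) ≤ 3 * (p h * (m * ε / 6)) := by
        have := mul_le_mul_of_nonneg_left hlt.le (mul_nonneg (hp0 h) (mul_pos hm0 hε).le)
        nlinarith
      linarith
    · have hempty : {f | 2 * ε < trueError L h X f} = ∅ := by
        refine Set.eq_empty_of_forall_notMem fun f hf => ?_
        have hone : trueError L h X f ≤ 1 := by
          calc trueError L h X f ≤ ∑ x, mass X x := Finset.sum_le_sum fun x _ =>
                mul_le_of_le_one_right (mass_nonneg _ _) (hL _ _ _).2
            _ = 1 := sum_univ_mass_eq_one X
        have : 2 * ε < trueError L h X f := hf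
        linarith
      have hzero : p h = 0 := by simp only [hp, hempty]; simp [prob]
      rw [hzero, zero_mul]
      positivity
  have hK : K ≤ m * (ε ^ 2 * δ) := (div_le_iff₀ (by positivity)).1 hmK
  have hsum : ∑ h, p h ≤ C.card * (3 * δ) := by
    have h1 := Finset.sum_le_sum fun h (_ : h ∈ Finset.univ) => hbound h
    rw [← Finset.sum_mul, ← Finset.mul_sum] at h1
    rw [one_div, inv_mul_le_iff₀ hC] at hinfo
    have h2 : (C.card : ℝ) * K ≤ C.card * (m * (ε ^ 2 * δ)) :=
      mul_le_mul_of_nonneg_left hK hC.le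
    refine le_of_mul_le_mul_right ?_ (show 0 < m * ε ^ 2 by positivity)
    linarith
  constructor
  · rw [prob_uniformOutputLaw, one_div, inv_mul_lt_iff₀ hC]
    refine hsum.trans_lt (mul_lt_mul_of_pos_left ?_ hC)
    linarith
  · have h := card_le_two_mul_ncard_lt p hp0 (c := 8 * δ) (by positivity) (by
      rw [Fintype.card_coe]
      refine hsum.trans (mul_le_mul_of_nonneg_left ?_ hC.le)
      linarith)
    rwa [Fintype.card_coe] at h
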